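/- Let $K$ be a field and let $D$ be an integral domain that is a finitely generated $K$-algebra, with quotient field $Q(D)$ and unit group $U(D)$. Let $R(D)$ be the reciprocal complement of $D$, i.e. the subring of $Q(D)$ generated by the elements $1/x$ with $x\in D\setminus\{0\}$, let $K(U(D))$ be the subfield of $Q(D)$ generated by $K$ and $U(D)$, and let $\dim$ denote Krull dimension. Then $$\dim R(D)\leq \dim D-\operatorname{trdeg}(K(U(D))/K).$$ In particular, if $K$ is algebraically closed and $U(D)\neq K\setminus\{0\}$ (where $K$ is identified with its image in $D$), then $\dim R(D)<\dim D$. -/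

import Mathlib

/-- The reciprocal complement of an integral domain `D`: the subring of its quotient field
generated by the inverses of the nonzero elements of `D`. -/
noncomputable def reciprocalComplement (D : Type*) [CommRing D] [IsDomain D] :
    Subring (FractionRing D) :=
  Subring.closure {y | ∃ x : D, x ≠ 0 ∧ y = (algebraMap D (FractionRing D) x)⁻¹}

/-- The field `K(U(D))`: the subfield of the quotient field of `D` generated over `K` by the
units of `D`. -/
noncomputable def unitField (K D : Type*) [Field K] [CommRing D] [IsDomain D] [Algebra K D] :
    IntermediateField K (FractionRing D) :=
  IntermediateField.adjoin K (algebraMap D (FractionRing D) '' {d : D | IsUnit d})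

/-! Write `L = K(U(D))`. An element of `L` is `r/s` with `r`, `s` in `K[U(D)] ⊆ D`. Here `r` lies in
`R(D)` because a unit is the reciprocal of its inverse, and `1/s` lies there by definition, so `L ⊆
R(D) ⊆ Q(D)`. A domain over a field has dimension at most its transcendence degree, hence `dim R(D)
≤ trdeg_L Q(D) = trdeg_K D - trdeg_K L`, and Noether normalization gives `trdeg_K D ≤ dim D`. -/

/-- A domain that is a proper quotient of a domain over a field has smaller transcendence degree. -/
theorem trdeg_add_one_le_of_surjective {F S T : Type*} [Field F] [CommRing S]
    [IsDomain S] [CommRing T] [IsDomain T] [Algebra F S] [Algebra F T] (f : S →ₐ[F] T)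
    (hf : Function.Surjective f) (hf' : ¬ Function.Injective f) :
    Cardinal.toENat (Algebra.trdeg F T) + 1 ≤ Cardinal.toENat (Algebra.trdeg F S) := by
  obtain ⟨x, hx, hx0⟩ : ∃ x, f x = 0 ∧ x ≠ 0 := by
    rw [injective_iff_map_eq_zero] at hf'
    push Not at hf'
    exact hf'
  obtain ⟨ι, b, hb⟩ := exists_isTranscendenceBasis' F T
  choose g hg using hf
  have hfy : f ∘ (g ∘ b) = b := funext fun i ↦ hg (b i)
  have hy : AlgebraicIndependent F (g ∘ b) := .of_comp f (by rw [hfy]; exact hb.1)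
  -- If `x` were algebraic over `F[g ∘ b]`, then `ker f` would meet that subalgebra nontrivially;
  -- but `f` is injective there, since it sends `g ∘ b` to the independent family `b`.
  have htr : Transcendental (Algebra.adjoin F (Set.range (g ∘ b))) x := by
    intro halg
    refine Ideal.comap_ne_bot_of_algebraic_mem (I := RingHom.ker f) hx0 hx halg ?_
    rw [eq_bot_iff]
    rintro ⟨a, ha⟩ hfa
    rw [Algebra.adjoin_range_eq_range_aeval] at ha
    obtain ⟨q, rfl⟩ := ha
    have hq : MvPolynomial.aeval b q = 0 := by
      have hcomp : (MvPolynomial.aeval b : MvPolynomial ι F →ₐ[F] T) =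
          f.comp (MvPolynomial.aeval (g ∘ b)) := by
        ext i
        simp [hg]
      rw [hcomp]
      exact hfa
    have hq0 := hb.1.eq_zero_of_aeval_eq_zero q hq
    exact Subtype.ext (by simp [hq0])
  have hcard := (AlgebraicIndependent.option_iff.mpr ⟨hy, htr⟩).lift_cardinalMk_le_trdeg
  have hcard' := Cardinal.toENat.monotone' hcard
  rw [← hb.cardinalMk_eq_trdeg]
  simpa using hcard'

/-- The Krull dimension of a domain over a field is at most its transcendence degree. -/
theorem ringKrullDim_le_trdeg (F R : Type*) [Field F] [CommRing R] [IsDomain R] [Algebra F R] :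
    ringKrullDim R ≤ (Cardinal.toENat (Algebra.trdeg F R) : ℕ∞) := by
  -- Quotienting by the smallest prime of the chain lets the induction prepend primes.
  have key (p : LTSeries (PrimeSpectrum R)) :
      (p.length : ℕ∞) ≤ Cardinal.toENat (Algebra.trdeg F (R ⧸ p.head.asIdeal)) := by
    induction p using RelSeries.inductionOn with
    | singleton x => simp
    | cons p x hx ih =>
      have hlt : x.asIdeal < p.head.asIdeal := hx
      have hstep := trdeg_add_one_le_of_surjective
        (Ideal.Quotient.factorₐ F hlt.le) (Ideal.Quotient.factor_surjective hlt.le) (by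
          intro hinj
          refine hlt.not_ge fun a ha ↦ ?_
          rw [← Ideal.Quotient.eq_zero_iff_mem] at ha ⊢
          exact hinj (by simpa using ha))
      simp only [RelSeries.cons_length, RelSeries.head_cons, Nat.cast_add, Nat.cast_one]
      exact (add_le_add_left ih 1).trans hstep
  refine iSup_le fun p ↦ WithBot.coe_le_coe.mpr ((key p).trans ?_)
  exact Cardinal.toENat.monotone'
    (trdeg_le_of_surjective (Ideal.Quotient.mkₐ F _) Ideal.Quotient.mk_surjective)

/-- Chains of primes lift along integral extensions. -/
theorem ringKrullDim_le_of_isIntegral_of_injective {A B : Type*} [CommRing A] [CommRing B]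
    [Algebra A B] [Algebra.IsIntegral A B] (h : Function.Injective (algebraMap A B)) :
    ringKrullDim A ≤ ringKrullDim B := by
  -- Recording the last prime lets going-up extend the lifted chain at its top.
  have key (p : LTSeries (PrimeSpectrum A)) : ∃ q : LTSeries (PrimeSpectrum B),
      q.length = p.length ∧ q.last.comap (algebraMap A B) = p.last := by
    induction p using RelSeries.inductionOn' with
    | singleton x =>
      obtain ⟨Q, -, hQ, hQx⟩ := Ideal.exists_ideal_over_prime_of_isIntegral x.asIdeal (⊥ : Ideal B)
        (by rw [← RingHom.ker_eq_comap_bot, (RingHom.injective_iff_ker_eq_bot _).mp h]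
            exact bot_le)
      exact ⟨RelSeries.singleton _ ⟨Q, hQ⟩, rfl, PrimeSpectrum.ext hQx⟩
    | snoc p x hx ih =>
      obtain ⟨q, hq, hqp⟩ := ih
      have hlt : p.last < x := hx
      obtain ⟨Q, hle, hQ, hQx⟩ := Ideal.exists_ideal_over_prime_of_isIntegral x.asIdeal
        q.last.asIdeal (by
          rw [← PrimeSpectrum.comap_asIdeal, hqp]
          exact hlt.le)
      have hQ' : PrimeSpectrum.comap (algebraMap A B) ⟨Q, hQ⟩ = x := PrimeSpectrum.ext hQx
      have hne : q.last ≠ ⟨Q, hQ⟩ := fun he ↦ hlt.ne (by rw [← hqp, he, hQ'])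
      refine ⟨q.snoc ⟨Q, hQ⟩ (lt_of_le_of_ne (α := PrimeSpectrum B) hle hne), by simp [hq], by simpa using hQ'⟩
  refine iSup_le fun p ↦ ?_
  obtain ⟨q, hq, -⟩ := key p
  rw [← hq]
  exact Order.LTSeries.length_le_krullDim q

/-- The transcendence degree of an affine domain is at most its Krull dimension. -/
theorem trdeg_le_ringKrullDim (K D : Type*) [Field K] [CommRing D] [IsDomain D] [Algebra K D]
    [Algebra.FiniteType K D] :
    ((Cardinal.toENat (Algebra.trdeg K D) : ℕ∞) : WithBot ℕ∞) ≤ ringKrullDim D := by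
  obtain ⟨s, g, hg, hint⟩ := exists_integral_inj_algHom_of_fg K D
  let := g.toRingHom.toAlgebra
  have : IsScalarTower K (MvPolynomial (Fin s) K) D := .of_algHom g
  have : Algebra.IsIntegral (MvPolynomial (Fin s) K) D := ⟨hint⟩
  have hinj : Function.Injective (algebraMap (MvPolynomial (Fin s) K) D) := hg
  have : FaithfulSMul (MvPolynomial (Fin s) K) D :=
    (faithfulSMul_iff_algebraMap_injective _ _).mpr hinj
  have htr := lift_trdeg_add_eq K (MvPolynomial (Fin s) K) D
  rw [trdeg_eq_zero (R := MvPolynomial (Fin s) K), MvPolynomial.trdeg_of_isDomain] at htr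
  have hs : Cardinal.toENat (Algebra.trdeg K D) = s := by
    simpa using (congrArg Cardinal.toENat htr).symm
  have hdim := MvPolynomial.ringKrullDim_of_isNoetherianRing (R := K) (ι := Fin s)
  rw [ringKrullDim_eq_zero_of_field, Nat.card_fin, zero_add] at hdim
  rw [hs]
  exact hdim.symm.le.trans (ringKrullDim_le_of_isIntegral_of_injective hinj)

section

variable (K D : Type*) [Field K] [CommRing D] [IsDomain D] [Algebra K D]

theorem inv_algebraMap_mem_reciprocalComplement {x : D} :
    (algebraMap D (FractionRing D) x)⁻¹ ∈ reciprocalComplement D := by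
  by_cases hx : x = 0
  · simp [hx]
  · exact Subring.subset_closure ⟨x, hx, rfl⟩

theorem algebraMap_mem_reciprocalComplement_of_isUnit {u : D} (hu : IsUnit u) :
    algebraMap D (FractionRing D) u ∈ reciprocalComplement D := by
  obtain ⟨u, rfl⟩ := hu
  have h : algebraMap D (FractionRing D) u =
      (algebraMap D (FractionRing D) (↑u⁻¹ : D))⁻¹ := by
    exact eq_inv_of_mul_eq_one_left (by rw [← map_mul, Units.mul_inv, map_one])
  rw [h]
  exact inv_algebraMap_mem_reciprocalComplement D

/-- The field generated by the units of `D` is contained in the reciprocal complement. -/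
theorem mem_reciprocalComplement_of_mem_unitField {z : FractionRing D}
    (hz : z ∈ unitField K D) : z ∈ reciprocalComplement D := by
  have hadj {y : FractionRing D}
      (hy : y ∈ Algebra.adjoin K (algebraMap D (FractionRing D) '' {d : D | IsUnit d})) :
      y ∈ reciprocalComplement D ∧ y⁻¹ ∈ reciprocalComplement D := by
    constructor
    · induction hy using Algebra.adjoin_induction with
      | mem y hy =>
        obtain ⟨u, hu, rfl⟩ := hy
        exact algebraMap_mem_reciprocalComplement_of_isUnit D hu
      | algebraMap c =>
        rw [IsScalarTower.algebraMap_apply K D]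
        by_cases hc : c = 0
        · simp [hc]
        · exact algebraMap_mem_reciprocalComplement_of_isUnit D
            ((IsUnit.mk0 c hc).map (algebraMap K D))
      | add _ _ _ _ hx hy => exact add_mem hx hy
      | mul _ _ _ _ hx hy => exact mul_mem hx hy
    -- `K[U(D)]` lies in the image of `D`, so its elements have reciprocals in `R(D)`.
    · have hle : Algebra.adjoin K (algebraMap D (FractionRing D) '' {d : D | IsUnit d}) ≤
          (IsScalarTower.toAlgHom K D (FractionRing D)).range := by
        rw [Algebra.adjoin_le_iff]
        rintro _ ⟨u, -, rfl⟩
        exact ⟨u, rfl⟩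
      obtain ⟨x, rfl⟩ := hle hy
      exact inv_algebraMap_mem_reciprocalComplement D
  rw [unitField, IntermediateField.mem_adjoin_iff_div] at hz
  obtain ⟨r, hr, s, hs, rfl⟩ := hz
  rw [div_eq_mul_inv]
  exact mul_mem (hadj hr).1 (hadj hs).2

theorem ringKrullDim_reciprocalComplement_le_trdeg :
    ringKrullDim (reciprocalComplement D) ≤
      (Cardinal.toENat (Algebra.trdeg (unitField K D) (FractionRing D)) : ℕ∞) := by
  let i : unitField K D →+* reciprocalComplement D :=
    (algebraMap (unitField K D) (FractionRing D)).codRestrict _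
      fun z ↦ mem_reciprocalComplement_of_mem_unitField K D z.2
  let := i.toAlgebra
  let j : reciprocalComplement D →ₐ[unitField K D] FractionRing D :=
    { (reciprocalComplement D).subtype with commutes' := fun _ ↦ rfl }
  refine (ringKrullDim_le_trdeg (unitField K D) (reciprocalComplement D)).trans ?_
  exact WithBot.coe_le_coe.mpr
    (Cardinal.toENat.monotone' (trdeg_le_of_injective j Subtype.val_injective))

theorem trdeg_unitField_add_trdeg :
    Algebra.trdeg K (unitField K D) + Algebra.trdeg (unitField K D) (FractionRing D) =
      Algebra.trdeg K D := by
  have : FaithfulSMul K D :=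
    (faithfulSMul_iff_algebraMap_injective _ _).mpr (algebraMap K D).injective
  have : Algebra.IsAlgebraic D (FractionRing D) := IsLocalization.isAlgebraic _ (nonZeroDivisors D)
  rw [trdeg_add_eq, ← trdeg_add_eq K D (A := FractionRing D), trdeg_eq_zero (R := D), add_zero]

/-- Over an algebraically closed field, a unit outside the field is transcendental. -/
theorem trdeg_unitField_ne_zero [IsAlgClosed K]
    (h : {d : D | IsUnit d} ≠ algebraMap K D '' {c : K | c ≠ 0}) :
    Algebra.trdeg K (unitField K D) ≠ 0 := by
  intro h0
  have : Algebra.IsAlgebraic K (unitField K D) := trdeg_eq_zero_iff.mp h0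
  refine h (Set.Subset.antisymm (fun u hu ↦ ?_) ?_)
  · have hmem : algebraMap D (FractionRing D) u ∈ unitField K D :=
      IntermediateField.subset_adjoin _ _ ⟨u, hu, rfl⟩
    obtain ⟨c, hc⟩ := (IsAlgClosed.algebraMap_bijective_of_isIntegral (k := K)
      (K := unitField K D)).2 ⟨_, hmem⟩
    have hcu : algebraMap K D c = u := by
      apply IsFractionRing.injective D (FractionRing D)
      rw [← IsScalarTower.algebraMap_apply]
      exact congrArg Subtype.val hc
    refine ⟨c, ?_, hcu⟩
    rintro rfl
    exact hu.ne_zero (by rw [← hcu, map_zero])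
  · rintro _ ⟨c, hc, rfl⟩
    exact (IsUnit.mk0 c hc).map (algebraMap K D)

end

theorem proposition3p10 (K D : Type*) [Field K] [CommRing D] [IsDomain D] [Algebra K D]
    [Algebra.FiniteType K D] :
    ringKrullDim (reciprocalComplement D) +
        ((Cardinal.toENat (Algebra.trdeg K (unitField K D)) : ℕ∞) : WithBot ℕ∞) ≤
      ringKrullDim D ∧
    (IsAlgClosed K →
      {d : D | IsUnit d} ≠ algebraMap K D '' {c : K | c ≠ 0} →
      ringKrullDim (reciprocalComplement D) < ringKrullDim D) := by
  have hmain : ringKrullDim (reciprocalComplement D) +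
      ((Cardinal.toENat (Algebra.trdeg K (unitField K D)) : ℕ∞) : WithBot ℕ∞) ≤
      ringKrullDim D := by
    refine le_trans ?_ (trdeg_le_ringKrullDim K D)
    rw [← trdeg_unitField_add_trdeg K D, map_add, add_comm, WithBot.coe_add]
    exact add_le_add le_rfl (ringKrullDim_reciprocalComplement_le_trdeg K D)
  refine ⟨hmain, fun _ h ↦ ?_⟩
  have hone : (1 : ℕ∞) ≤ Cardinal.toENat (Algebra.trdeg K (unitField K D)) := by
    rw [Cardinal.one_le_toENat, Cardinal.one_le_iff_ne_zero]
    exact trdeg_unitField_ne_zero K D h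
  -- Finiteness is needed for strictness: `a + 1 ≤ b` does not give `a < b` when `a = ⊤`.
  have hfin : ringKrullDim D < ⊤ := by
    have : FaithfulSMul K D :=
      (faithfulSMul_iff_algebraMap_injective _ _).mpr (algebraMap K D).injective
    refine (ringKrullDim_le_trdeg K D).trans_lt ?_
    rw [← WithBot.coe_top, WithBot.coe_lt_coe]
    exact Cardinal.toENat_lt_top.mpr (trdeg_lt_aleph0_of_finiteType)
  have hstep : ringKrullDim (reciprocalComplement D) + 1 ≤ ringKrullDim D :=
    le_trans (by gcongr; exact_mod_cast hone) hmain
  have h0 : 0 ≤ ringKrullDim (reciprocalComplement D) := ringKrullDim_nonneg_of_nontrivial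
  generalize ringKrullDim (reciprocalComplement D) = a at *
  generalize ringKrullDim D = b at *
  induction a with
  | bot => simp at h0
  | coe a =>
  induction b with
  | bot => exact absurd (le_bot_iff.mp hstep) (by simp)
  | coe b =>
  have hb : b ≠ ⊤ := by
    rintro rfl
    exact lt_irrefl _ hfin
  have hab : a + 1 ≤ b := by exact_mod_cast hstep
  have ha : a ≠ ⊤ := by
    rintro rfl
    exact hb (top_le_iff.mp (by simpa using hab))
  exact WithBot.coe_lt_coe.mpr ((ENat.add_one_le_iff ha).mp hab)
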